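/- For $n\ge 0$ let $Q_n$ be the hypercube graph on $\{0,1\}^n$, in which two binary sequences are adjacent if and only if they differ in exactly one coordinate. A $d$-subcube of $\{0,1\}^n$ is a subset $C\subseteq\{0,1\}^n$ such that the subgraph of $Q_n$ induced by $C$ is isomorphic to $Q_d$; for $n\ge d$ there are exactly $\binom nd 2^{n-d}$ of them. For $S\subseteq\{0,1\}^n$ and integers $d$ and $0\le s\le 2^d$, let $\Lambda(S,d,s)$ be the number of $d$-subcubes $C$ of $\{0,1\}^n$ with $|S\cap C|=s$, and for $n\ge d$ let $$\Lambda(n,d,s):=\max\{\Lambda(S,d,s) : S\subseteq\{0,1\}^n\},\qquad \lambda(d,s):=\lim_{n\to\infty}\frac{\Lambda(n,d,s)}{\binom nd\,2^{n-d}}.$$ Then the limits $\lambda(3,2)$, $\lambda(4,2)$ and $\lambda(4,4)$ exist, and $$\lambda(3,2)=\frac89,\qquad \lambda(4,2)=\frac{264}{343},\qquad \lambda(4,4)=\frac{26}{27}.$$ -/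

import Mathlib

/-- The `n`-dimensional hypercube graph `Q_n` on binary sequences of length `n`: two sequences are
adjacent when they differ in exactly one coordinate. -/
def hypercubeGraph (n : ℕ) : SimpleGraph (Fin n → Bool) where
  Adj x y := hammingDist x y = 1
  symm := ⟨fun x y h => by rw [hammingDist_comm]; exact h⟩
  loopless := ⟨fun x h => by simp at h⟩

/-- A `d`-subcube of `{0,1}^n`: a set of vertices that induces in `Q_n` a copy of `Q_d`. -/
def IsSubcube {n : ℕ} (d : ℕ) (C : Finset (Fin n → Bool)) : Prop :=
  Nonempty (hypercubeGraph d ≃g (hypercubeGraph n).induce (C : Set (Fin n → Bool)))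

open Classical in
/-- `Λ(S,d,s)`: the number of `d`-subcubes that contain exactly `s` points of `S`. -/
noncomputable def subcubeCount {n : ℕ} (S : Finset (Fin n → Bool)) (d s : ℕ) : ℕ :=
  (Finset.univ.filter
    (fun C : Finset (Fin n → Bool) => IsSubcube d C ∧ (S ∩ C).card = s)).card

/-- The statistics function `Λ(n,d,s)`: the maximum of `Λ(S,d,s)` over all `S ⊆ {0,1}^n`. -/
noncomputable def statisticsFunction (n d s : ℕ) : ℕ :=
  (Finset.univ : Finset (Finset (Fin n → Bool))).sup (fun S => subcubeCount S d s)

/-- The maximal density of `d`-subcubes of `{0,1}^n` with exactly `s` configuration points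
(meaningful for `n ≥ d`). -/
noncomputable def statisticsDensity (d s n : ℕ) : ℝ :=
  (statisticsFunction n d s : ℝ) / ((n.choose d : ℝ) * 2 ^ (n - d))

/-- `c` is the statistics constant `λ(d,s)`: the limit of the maximal densities as `n → ∞`
exists and equals `c`. -/
def IsStatisticsConstant (d s : ℕ) (c : ℝ) : Prop :=
  Filter.Tendsto (statisticsDensity d s) Filter.atTop (nhds c)

/-!
Upper bounds: attach to each coloured `m`-cube `σ` a positive semidefinite form indexed by coloured
`m`-cubes. For a placed `m`-cube of `{0,1}^n`, the sum of the form of its colouring over all pairs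
of parallel neighbouring cubes is nonnegative. The pairs of distinct neighbours span
`(m + 2)`-cubes, and the equal pairs are of lower order. Hence, if on every coloured
`(m + 2)`-cube `A` times the indicator of exactly `s` marked vertices plus a sum of such form values
is at most `B`, then the density is at most `B / A + O(1 / n)`. Suitable forms exist on coloured
edges for `λ(3,2)` and on coloured squares for `λ(4,2)` and `λ(4,4)`; the inequality is a finite
check.

Lower bounds: choose vectors `a 1, …, a n` in `𝔽₂^k` and let `S` be the set of `x` with
`∑ x i • a i = 0`. A subcube in directions `i₁, …, i_d` meets all the fibres of this map in
`2 ^ (d - k)` points as soon as `a i₁, …, a i_d` span. For random nonzero `a i`, the expected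
density of such subcubes is the probability that `d` random nonzero vectors span.
-/

open scoped Finset

/-! ### Flipping a coordinate -/

/-- The neighbour of the vertex `x` of a hypercube in direction `t`. -/
def flipAt {n : ℕ} (x : Fin n → Bool) (t : Fin n) : Fin n → Bool := Function.update x t (!x t)

section Flip

variable {n d : ℕ}

theorem flipAt_apply_self (x : Fin n → Bool) (t : Fin n) : flipAt x t t = !x t := by simp [flipAt]

theorem flipAt_apply_of_ne (x : Fin n → Bool) {t r : Fin n} (h : r ≠ t) : flipAt x t r = x r := by
  simp [flipAt, h]

theorem flipAt_flipAt (x : Fin n → Bool) (t : Fin n) : flipAt (flipAt x t) t = x := by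
  simp [flipAt]

theorem flipAt_comm (x : Fin n → Bool) (t r : Fin n) :
    flipAt (flipAt x t) r = flipAt (flipAt x r) t := by
  obtain rfl | h := eq_or_ne t r
  · rfl
  · simp [flipAt, h, h.symm, Function.update_comm h]

theorem flipAt_cons_succ (a : Bool) (x : Fin n → Bool) (t : Fin n) :
    flipAt (Fin.cons a x : Fin (n + 1) → Bool) t.succ = Fin.cons a (flipAt x t) := by
  simp [flipAt, Fin.cons_update]

theorem flipAt_injective (x : Fin n → Bool) : Function.Injective (flipAt x) := by
  intro t r h
  by_contra hne
  simpa [flipAt, hne] using congrFun h t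

theorem hammingDist_eq_one_iff {x y : Fin n → Bool} :
    hammingDist x y = 1 ↔ ∃ t, y = flipAt x t := by
  simp only [hammingDist, Finset.card_eq_one, Finset.ext_iff, Finset.mem_filter_univ,
    Finset.mem_singleton, funext_iff]
  refine exists_congr fun t => forall_congr' fun r => ?_
  obtain rfl | h := eq_or_ne r t
  · cases hx : x r <;> cases y r <;> simp [flipAt_apply_self, hx]
  · simp [flipAt_apply_of_ne x h, h, eq_comm]

theorem flipAt_induction {P : (Fin d → Bool) → Prop} (bot : P ⊥)
    (flip : ∀ u i, P u → P (flipAt u i)) (u : Fin d → Bool) : P u := by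
  suffices h : ∀ s : Finset (Fin d), P fun i => decide (i ∈ s) by
    simpa using h {i | u i = true}
  intro s
  induction s using Finset.induction_on with
  | empty => exact bot
  | insert i s hi ih =>
    convert flip _ i ih using 1
    ext j
    obtain rfl | h := eq_or_ne j i
    · simp [flipAt_apply_self, hi]
    · simp [flipAt_apply_of_ne _ h, h]

theorem eq_of_flipAt_flipAt_eq {x : Fin n → Bool} {p q a b : Fin n} (hpq : p ≠ q) (hap : a ≠ p)
    (h : flipAt (flipAt x p) a = flipAt (flipAt x q) b) : a = q := by
  by_contra haq
  have hp := congrFun h p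
  have hq := congrFun h q
  rw [flipAt_apply_of_ne _ hap.symm, flipAt_apply_self] at hp
  rw [flipAt_apply_of_ne _ (Ne.symm haq), flipAt_apply_of_ne _ hpq.symm] at hq
  obtain rfl | hb := eq_or_ne b p
  · simp [flipAt_apply_of_ne _ hpq.symm, flipAt_apply_self] at hq
  · simp [flipAt_apply_of_ne _ hb.symm, flipAt_apply_of_ne _ hpq] at hp

end Flip

/-! ### Placements of a cube in a cube -/

/-- A placement of the `d`-cube in the `n`-cube: a base point and `d` distinct directions. Every
`d`-subcube is the image of `2 ^ d * d!` placements. -/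
abbrev Placement (d n : ℕ) : Type := (Fin n → Bool) × (Fin d ↪ Fin n)

namespace Placement

variable {n d m : ℕ}

/-- The vertex of the placed cube with coordinate vector `u`. -/
noncomputable def vertex (q : Placement d n) (u : Fin d → Bool) : Fin n → Bool :=
  fun t => xor (q.1 t) (Function.extend q.2 u ⊥ t)

theorem vertex_apply_dir (q : Placement d n) (u : Fin d → Bool) (i : Fin d) :
    q.vertex u (q.2 i) = xor (q.1 (q.2 i)) (u i) := by
  rw [vertex, q.2.injective.extend_apply]

theorem vertex_apply_of_notMem_range (q : Placement d n) (u : Fin d → Bool) {t : Fin n}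
    (ht : t ∉ Set.range q.2) : q.vertex u t = q.1 t := by
  rw [vertex, Function.extend_apply' _ _ _ ht]
  simp

theorem vertex_bot (q : Placement d n) : q.vertex ⊥ = q.1 := by
  funext t
  by_cases ht : t ∈ Set.range q.2
  · obtain ⟨i, rfl⟩ := ht
    simp [vertex_apply_dir]
  · exact vertex_apply_of_notMem_range q _ ht

theorem vertex_flipAt (q : Placement d n) (u : Fin d → Bool) (i : Fin d) :
    q.vertex (flipAt u i) = flipAt (q.vertex u) (q.2 i) := by
  funext t
  by_cases ht : t ∈ Set.range q.2
  · obtain ⟨j, rfl⟩ := ht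
    obtain rfl | hj := eq_or_ne j i
    · simp [vertex_apply_dir, flipAt_apply_self]
    · simp [vertex_apply_dir, flipAt_apply_of_ne _ hj, flipAt_apply_of_ne _ (q.2.injective.ne hj)]
  · rw [flipAt_apply_of_ne _ fun h => ht ⟨i, h.symm⟩]
    simp only [vertex_apply_of_notMem_range q _ ht]

theorem vertex_cons_false (q : Placement (d + 1) n) (w : Fin d → Bool) :
    q.vertex (Fin.cons false w) = vertex (q.1, (Fin.succEmb d).trans q.2) w := by
  induction w using flipAt_induction with
  | bot =>
    have : (Fin.cons false ⊥ : Fin (d + 1) → Bool) = ⊥ := by ext i; cases i using Fin.cases <;> rfl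
    rw [this, vertex_bot, vertex_bot]
  | flip w i ih => rw [← flipAt_cons_succ, vertex_flipAt, vertex_flipAt, ih]; rfl

theorem vertex_cons_true (q : Placement (d + 1) n) (w : Fin d → Bool) :
    q.vertex (Fin.cons true w) = vertex (flipAt q.1 (q.2 0), (Fin.succEmb d).trans q.2) w := by
  induction w using flipAt_induction with
  | bot =>
    have : (Fin.cons true ⊥ : Fin (d + 1) → Bool) = flipAt ⊥ 0 := by
      ext i; cases i using Fin.cases <;> simp [flipAt]
    rw [this, vertex_flipAt, vertex_bot, vertex_bot]
  | flip w i ih => rw [← flipAt_cons_succ, vertex_flipAt, vertex_flipAt, ih]; rfl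

theorem vertex_injective (q : Placement d n) : Function.Injective q.vertex := by
  intro u v h
  funext i
  simpa [vertex_apply_dir] using congrFun h (q.2 i)

theorem hammingDist_vertex_eq_one_iff (q : Placement d n) {u v : Fin d → Bool} :
    hammingDist (q.vertex u) (q.vertex v) = 1 ↔ hammingDist u v = 1 := by
  simp only [hammingDist_eq_one_iff]
  constructor
  · rintro ⟨t, ht⟩
    have hrange : t ∈ Set.range q.2 := by
      by_contra h
      simpa [flipAt_apply_self, vertex_apply_of_notMem_range q _ h] using congrFun ht t
    obtain ⟨i, rfl⟩ := hrange
    exact ⟨i, q.vertex_injective (ht.trans (q.vertex_flipAt u i).symm)⟩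
  · rintro ⟨i, rfl⟩
    exact ⟨q.2 i, q.vertex_flipAt u i⟩

/-- The placement in the `n`-cube of a cube placed in the placed cube. -/
noncomputable def comp (q : Placement d n) (r : Placement m d) : Placement m n :=
  (q.vertex r.1, r.2.trans q.2)

theorem vertex_comp (q : Placement d n) (r : Placement m d) (u : Fin m → Bool) :
    (q.comp r).vertex u = q.vertex (r.vertex u) := by
  induction u using flipAt_induction with
  | bot => simp [vertex_bot, comp]
  | flip u i ih => rw [vertex_flipAt, ih, vertex_flipAt, vertex_flipAt]; rfl

theorem vertex_inj {q r : Placement d n} : q.vertex = r.vertex ↔ q = r := by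
  refine ⟨fun h => ?_, fun h => h ▸ rfl⟩
  have hbase : q.1 = r.1 := by rw [← vertex_bot, h, vertex_bot]
  refine Prod.ext hbase (DFunLike.ext _ _ fun i => flipAt_injective q.1 ?_)
  nth_rw 2 [hbase]
  rw [← vertex_bot, ← vertex_flipAt, h, vertex_flipAt, vertex_bot]

theorem comp_injective (q : Placement d n) :
    Function.Injective (q.comp : Placement m d → Placement m n) := by
  intro r r' h
  refine vertex_inj.1 (funext fun u => q.vertex_injective ?_)
  rw [← vertex_comp, ← vertex_comp, h]

theorem comp_right_injective (r : Placement d d) :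
    Function.Injective fun q : Placement d n => q.comp r := by
  intro q q' h
  refine vertex_inj.1 (Function.Surjective.injective_comp_right
    (Finite.injective_iff_surjective.1 r.vertex_injective) ?_)
  funext u
  simpa [vertex_comp] using congrArg (vertex · u) h

theorem card_eq (d n : ℕ) : Fintype.card (Placement d n) = 2 ^ n * n.descFactorial d := by
  simp [Fintype.card_embedding_eq]

theorem card_pos (hd : d ≤ n) : 0 < Fintype.card (Placement d n) := by
  rw [card_eq]
  exact Nat.mul_pos (by positivity) (Nat.descFactorial_pos.2 hd)

theorem card_succ (d n : ℕ) :
    Fintype.card (Placement (d + 1) n) = (n - d) * Fintype.card (Placement d n) := by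
  rw [card_eq, card_eq, Nat.descFactorial_succ]
  ring

theorem vertex_toEmbedding (x : Fin d → Bool) (π : Equiv.Perm (Fin d)) (u : Fin d → Bool) :
    vertex (x, π.toEmbedding) u = fun t => xor (x t) (u (π.symm t)) := by
  funext t
  obtain ⟨i, rfl⟩ := π.surjective t
  simpa using vertex_apply_dir (x, π.toEmbedding) u i

/-- The direction of the edge from `φ u` to `φ (flipAt u i)` does not depend on `u`, because
opposite edges of a square have the same direction. -/
theorem exists_vertex_eq {φ : (Fin d → Bool) → (Fin n → Bool)} (hφ : Function.Injective φ)
    (hadj : ∀ u v, hammingDist u v = 1 → hammingDist (φ u) (φ v) = 1) :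
    ∃ q : Placement d n, q.vertex = φ := by
  have hstep (u i) : ∃ t, φ (flipAt u i) = flipAt (φ u) t :=
    hammingDist_eq_one_iff.1 (hadj _ _ (hammingDist_eq_one_iff.2 ⟨i, rfl⟩))
  choose dir hdir using hstep
  have dir_injective (u) : Function.Injective (dir u) := fun i j hij =>
    flipAt_injective u (hφ (by rw [hdir, hdir, hij]))
  have dir_flipAt (u i j) : dir (flipAt u i) j = dir u j := by
    obtain rfl | hij := eq_or_ne i j
    · apply flipAt_injective (φ (flipAt u i))
      rw [← hdir, flipAt_flipAt, hdir, flipAt_flipAt]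
    · refine eq_of_flipAt_flipAt_eq (x := φ u) (b := dir (flipAt u j) i)
        ((dir_injective u).ne hij) (fun hback => hij (flipAt_injective (flipAt u i) (hφ ?_))) ?_
      · rw [flipAt_flipAt, hdir (flipAt u i), hback, hdir, flipAt_flipAt]
      · rw [← hdir, ← hdir, ← hdir, ← hdir, flipAt_comm]
  have dir_eq (u) : dir u = dir ⊥ := by
    induction u using flipAt_induction with
    | bot => rfl
    | flip u i ih => rw [← ih]; exact funext (dir_flipAt u i)
  refine ⟨(φ ⊥, ⟨dir ⊥, dir_injective ⊥⟩), funext fun u => ?_⟩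
  induction u using flipAt_induction with
  | bot => exact vertex_bot _
  | flip u i ih => rw [vertex_flipAt, ih, hdir, dir_eq u]; rfl

end Placement

/-! ### Counting subcubes through placements -/

namespace Placement

variable {n d : ℕ}

/-- The subcube given by a placement. -/
noncomputable def image (q : Placement d n) : Finset (Fin n → Bool) := Finset.univ.image q.vertex

theorem mem_image {q : Placement d n} {y : Fin n → Bool} : y ∈ q.image ↔ ∃ u, q.vertex u = y := by
  simp [image]

theorem image_eq_iff {q r : Placement d n} :
    r.image = q.image ↔ ∃ p : Placement d d, q.comp p = r := by
  constructor
  · intro h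
    have hmem (u) : ∃ w, q.vertex w = r.vertex u := by
      rw [← mem_image, ← h, mem_image]
      exact ⟨u, rfl⟩
    choose ψ hψ using hmem
    obtain ⟨p, hp⟩ := exists_vertex_eq (φ := ψ)
      (fun u v huv => r.vertex_injective (by rw [← hψ, ← hψ, huv]))
      (fun u v huv => q.hammingDist_vertex_eq_one_iff.1
        (by rwa [hψ, hψ, r.hammingDist_vertex_eq_one_iff]))
    exact ⟨p, vertex_inj.1 (funext fun u => by rw [vertex_comp, hp, hψ])⟩
  · rintro ⟨p, rfl⟩
    ext y
    simp only [mem_image, vertex_comp]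
    exact ((Finite.injective_iff_surjective.1 p.vertex_injective).exists
      (p := fun w => q.vertex w = y)).symm

end Placement

/-- A colouring of the `d`-cube, thought of as a set of marked vertices. -/
abbrev Coloring (d : ℕ) : Type := (Fin d → Bool) → Bool

/-- The colouring of the `d`-cube that marks the vertices which a placement sends into `S`. -/
noncomputable def coloring {n d : ℕ} (S : Finset (Fin n → Bool)) (q : Placement d n) :
    Coloring d := fun u => decide (q.vertex u ∈ S)

/-- The number of marked vertices of a coloured cube. -/
def numPoints {d : ℕ} (c : Coloring d) : ℕ := ∑ u, (c u).toNat

section Counting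

variable {n d : ℕ}

theorem coloring_comp {m : ℕ} (S : Finset (Fin n → Bool)) (q : Placement d n) (r : Placement m d) :
    coloring S (q.comp r) = coloring S q ∘ r.vertex := by
  funext u
  simp [coloring, Placement.vertex_comp]

theorem isSubcube_iff {C : Finset (Fin n → Bool)} :
    IsSubcube d C ↔ ∃ q : Placement d n, q.image = C := by
  constructor
  · rintro ⟨φ⟩
    obtain ⟨q, hq⟩ := Placement.exists_vertex_eq (φ := fun u => (φ u : Fin n → Bool))
      (Subtype.val_injective.comp φ.injective) fun u v huv => φ.map_rel_iff.2 huv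
    refine ⟨q, Finset.ext fun y => ?_⟩
    rw [Placement.mem_image, hq]
    exact ⟨fun ⟨u, hu⟩ => hu ▸ (φ u).2, fun hy => ⟨φ.symm ⟨y, hy⟩, by simp⟩⟩
  · rintro ⟨q, rfl⟩
    refine ⟨⟨Equiv.ofBijective (fun u => ⟨q.vertex u, Placement.mem_image.2 ⟨u, rfl⟩⟩) ⟨?_, ?_⟩,
      q.hammingDist_vertex_eq_one_iff⟩⟩
    · exact fun u v h => q.vertex_injective (congrArg Subtype.val h)
    · rintro ⟨y, hy⟩
      obtain ⟨u, rfl⟩ := Placement.mem_image.1 hy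
      exact ⟨u, rfl⟩

theorem card_inter_image (S : Finset (Fin n → Bool)) (q : Placement d n) :
    (S ∩ q.image).card = numPoints (coloring S q) := by
  rw [Finset.inter_comm, ← Finset.filter_mem_eq_inter, Placement.image, Finset.filter_image,
    Finset.card_image_of_injective _ q.vertex_injective, Finset.card_filter]
  exact Finset.sum_congr rfl fun u _ => by simp [coloring, Bool.toNat, Bool.cond_decide]

open Classical in
theorem subcubeCount_mul (S : Finset (Fin n → Bool)) (d s : ℕ) :
    subcubeCount S d s * (2 ^ d * d.factorial) =
      #{q : Placement d n | numPoints (coloring S q) = s} := by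
  rw [subcubeCount, Finset.card_eq_sum_card_fiberwise (f := Placement.image)
    (t := {C | IsSubcube d C ∧ (S ∩ C).card = s}), ← smul_eq_mul, ← Finset.sum_const]
  · refine Finset.sum_congr rfl fun C hC => ?_
    obtain ⟨hC, hs⟩ := (Finset.mem_filter_univ _).1 hC
    obtain ⟨q, rfl⟩ := isSubcube_iff.1 hC
    rw [← Nat.descFactorial_self, ← Placement.card_eq, ← Finset.card_univ,
      ← Finset.card_image_of_injective Finset.univ q.comp_injective]
    congr 1
    ext r
    simp only [Finset.mem_image, Finset.mem_univ, true_and,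
      Finset.mem_filter, ← card_inter_image, ← Placement.image_eq_iff]
    exact ⟨fun h => ⟨h ▸ hs, h⟩, And.right⟩
  · intro q hq
    simp only [Finset.coe_filter, Finset.mem_univ, true_and, Set.mem_ofPred_eq] at hq ⊢
    exact ⟨isSubcube_iff.2 ⟨q, rfl⟩, by rw [card_inter_image, hq]⟩

theorem subcubeCount_div (S : Finset (Fin n → Bool)) (s : ℕ) (hd : d ≤ n) :
    (subcubeCount S d s : ℝ) / ((n.choose d : ℝ) * 2 ^ (n - d)) =
      (#{q : Placement d n | numPoints (coloring S q) = s} : ℝ) /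
        Fintype.card (Placement d n) := by
  have hpow : (2 : ℝ) ^ n = 2 ^ (n - d) * 2 ^ d := by rw [← pow_add, Nat.sub_add_cancel hd]
  have hchoose : (n.choose d : ℝ) ≠ 0 := by exact_mod_cast (Nat.choose_pos hd).ne'
  rw [← subcubeCount_mul, Placement.card_eq, Nat.descFactorial_eq_factorial_mul_choose]
  push_cast
  rw [hpow]
  field_simp

end Counting

/-! ### Averaging positive semidefinite forms over placements -/

section Averaging

variable {m n : ℕ}

theorem sum_embedding_succ {β : Type*} [AddCommMonoid β] (f : Fin n → (Fin m ↪ Fin n) → β) :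
    ∑ g : Fin (m + 1) ↪ Fin n, f (g 0) ((Fin.succEmb m).trans g) =
      ∑ e : Fin m ↪ Fin n, ∑ k with k ∉ Set.range e, f k e := by
  rw [← (Equiv.embeddingFinSucc m (Fin n)).symm.sum_comp, Fintype.sum_sigma]
  refine Finset.sum_congr rfl fun e _ => ?_
  rw [Finset.sum_subtype _ (fun k => Finset.mem_filter_univ k)]
  refine Finset.sum_congr rfl fun k _ => ?_
  congr 1

theorem sum_embedding_add_sum_diag {β : Type*} [AddCommMonoid β]
    (f : Fin n → Fin n → (Fin m ↪ Fin n) → β) :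
    ∑ g : Fin (m + 2) ↪ Fin n, f (g 0) (g 1) ((Fin.succEmb m).trans ((Fin.succEmb _).trans g)) +
        ∑ g : Fin (m + 1) ↪ Fin n, f (g 0) (g 0) ((Fin.succEmb m).trans g) =
      ∑ e : Fin m ↪ Fin n, ∑ l with l ∉ Set.range e, ∑ k with k ∉ Set.range e, f k l e := by
  have hrange (g : Fin (m + 1) ↪ Fin n) (k : Fin n) :
      k ∉ Set.range g ↔ k ≠ g 0 ∧ k ∉ Set.range ((Fin.succEmb m).trans g) := by
    simp [Fin.forall_fin_succ, eq_comm]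
  have hpairs : ∑ g : Fin (m + 2) ↪ Fin n,
      f (g 0) (g 1) ((Fin.succEmb m).trans ((Fin.succEmb _).trans g)) =
      ∑ e : Fin m ↪ Fin n, ∑ l with l ∉ Set.range e,
        ∑ k with k ≠ l ∧ k ∉ Set.range e, f k l e := by
    rw [← sum_embedding_succ fun l e => ∑ k with k ≠ l ∧ k ∉ Set.range e, f k l e]
    simp only [← hrange]
    exact sum_embedding_succ fun k g => f k (g 0) ((Fin.succEmb m).trans g)
  rw [hpairs, sum_embedding_succ fun k e => f k k e, ← Finset.sum_add_distrib]
  refine Finset.sum_congr rfl fun e _ => ?_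
  rw [← Finset.sum_add_distrib]
  refine Finset.sum_congr rfl fun l hl => ?_
  rw [← Finset.add_sum_erase _ _ hl, add_comm, Finset.filter_and, Finset.filter_ne',
    Finset.erase_inter, Finset.univ_inter]

theorem sum_sum_nonneg_of_posSemidef {ι α : Type*} {M : Matrix α α ℤ} (hM : M.PosSemidef)
    (s : Finset ι) (F : ι → α) : 0 ≤ ∑ l ∈ s, ∑ k ∈ s, M (F k) (F l) := by
  have h := (hM.submatrix fun i : s => F i).dotProduct_mulVec_nonneg 1
  simp only [dotProduct, Matrix.mulVec, Matrix.submatrix_apply, Pi.star_apply, Pi.one_apply,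
    star_one, one_mul, mul_one] at h
  rw [Finset.sum_comm, ← Finset.sum_coe_sort]
  simpa only [← Finset.sum_coe_sort s] using h

/-- The colouring of the face of a coloured cube on which the first two coordinates are `a`, `b`. -/
def face (c : Coloring (m + 2)) (a b : Bool) : Coloring m :=
  fun w => c (Fin.cons a (Fin.cons b w))

variable (t : Coloring m → Matrix (Coloring m) (Coloring m) ℤ)

/-- The form belonging to the face on which the first two coordinates are `false`, evaluated at its
two neighbours. -/
def cornerForm (c : Coloring (m + 2)) : ℤ :=
  t (face c false false) (face c true false) (face c false true)

/-- The sum of the corner forms over the four faces that fix the first two coordinates. -/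
def ringForm (c : Coloring (m + 2)) : ℤ :=
  ∑ a, ∑ b, t (face c a b) (face c (!a) b) (face c a (!b))

variable (S : Finset (Fin n → Bool))

theorem cornerForm_coloring (q : Placement (m + 2) n) :
    cornerForm t (coloring S q) =
      let e := (Fin.succEmb m).trans ((Fin.succEmb _).trans q.2)
      t (coloring S (q.1, e)) (coloring S (flipAt q.1 (q.2 0), e))
        (coloring S (flipAt q.1 (q.2 1), e)) := by
  unfold cornerForm face coloring
  simp only [Placement.vertex_cons_false, Placement.vertex_cons_true]
  rfl

theorem neg_mul_card_le_sum_cornerForm (ht : ∀ σ, (t σ).PosSemidef) {K : ℤ}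
    (hK : ∀ σ F, t σ F F ≤ K) :
    -(K * Fintype.card (Placement (m + 1) n)) ≤
      ∑ q : Placement (m + 2) n, cornerForm t (coloring S q) := by
  set f : (Fin n → Bool) → Fin n → Fin n → (Fin m ↪ Fin n) → ℤ := fun x k l e =>
    t (coloring S (x, e)) (coloring S (flipAt x k, e)) (coloring S (flipAt x l, e))
  have hdiag : ∑ q : Placement (m + 1) n, f q.1 (q.2 0) (q.2 0) ((Fin.succEmb m).trans q.2) ≤
      K * Fintype.card (Placement (m + 1) n) := by
    refine (Finset.sum_le_card_nsmul _ _ K fun q _ => hK _ _).trans_eq ?_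
    rw [nsmul_eq_mul, Finset.card_univ, mul_comm]
  have hsum : 0 ≤ ∑ q : Placement (m + 2) n, cornerForm t (coloring S q) +
      ∑ q : Placement (m + 1) n, f q.1 (q.2 0) (q.2 0) ((Fin.succEmb m).trans q.2) := by
    simp only [cornerForm_coloring, Fintype.sum_prod_type, ← Finset.sum_add_distrib]
    refine Finset.sum_nonneg fun x _ => ?_
    refine le_of_le_of_eq ?_ (sum_embedding_add_sum_diag (f x)).symm
    exact Finset.sum_nonneg fun e _ =>
      sum_sum_nonneg_of_posSemidef (ht _) _ fun k => coloring S (flipAt x k, e)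
  linarith

theorem sum_coloring_comp_vertex {d : ℕ} {β : Type*} [AddCommMonoid β] (f : Coloring d → β)
    (r : Placement d d) :
    ∑ q : Placement d n, f (coloring S q ∘ r.vertex) = ∑ q : Placement d n, f (coloring S q) := by
  simp only [← coloring_comp]
  exact (Finite.injective_iff_bijective.1 r.comp_right_injective).sum_comp fun q => f (coloring S q)

theorem face_comp_vertex (c : Coloring (m + 2)) (π : Equiv.Perm (Fin (m + 2))) (a b a' b' : Bool) :
    face (c ∘ Placement.vertex ((Fin.cons a (Fin.cons b ⊥) : Fin (m + 2) → Bool) ∘ π,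
      π.symm.toEmbedding)) a' b' = face (fun u => c (u ∘ π)) (xor a a') (xor b b') := by
  funext w
  simp only [face, Function.comp_apply, Placement.vertex_toEmbedding, Equiv.symm_symm]
  congr 1
  funext j
  rw [Function.comp_apply]
  refine Fin.cases ?_ (Fin.cases ?_ fun i => ?_) (π j) <;> simp

theorem sum_ringForm_perm (π : Equiv.Perm (Fin (m + 2))) :
    ∑ q : Placement (m + 2) n, ringForm t (fun u => coloring S q (u ∘ π)) =
      4 * ∑ q : Placement (m + 2) n, cornerForm t (coloring S q) := by
  have hcorner (c : Coloring (m + 2)) (a b : Bool) :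
      t (face (fun u => c (u ∘ π)) a b) (face (fun u => c (u ∘ π)) (!a) b)
        (face (fun u => c (u ∘ π)) a (!b)) =
      cornerForm t (c ∘ Placement.vertex
        ((Fin.cons a (Fin.cons b ⊥) : Fin (m + 2) → Bool) ∘ π, π.symm.toEmbedding)) := by
    simp [cornerForm, face_comp_vertex]
  simp only [ringForm, hcorner]
  rw [Finset.sum_comm]
  simp_rw [Finset.sum_comm (s := (Finset.univ : Finset (Placement (m + 2) n)))]
  simp only [sum_coloring_comp_vertex, Fintype.sum_bool]
  ring

/-- The forms contribute only an error of the order of the number of `(m + 1)`-subcubes. -/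
theorem mul_card_numPoints_le {ι : Type*} [Fintype ι] (ht : ∀ σ, (t σ).PosSemidef) {K : ℤ}
    (hK : ∀ σ F, t σ F F ≤ K) (π : ι → Equiv.Perm (Fin (m + 2))) {s : ℕ} {A B : ℤ}
    (hcert : ∀ c : Coloring (m + 2), (if numPoints c = s then A else 0) +
      ∑ i, ringForm t (fun u => c (u ∘ π i)) ≤ B) :
    A * #{q : Placement (m + 2) n | numPoints (coloring S q) = s} ≤
      B * Fintype.card (Placement (m + 2) n) +
        4 * Fintype.card ι * K * Fintype.card (Placement (m + 1) n) := by
  have hcorner := neg_mul_card_le_sum_cornerForm t S ht hK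
  have hsum := Finset.sum_le_sum fun (q : Placement (m + 2) n) (_ : q ∈ Finset.univ) =>
    hcert (coloring S q)
  rw [Finset.sum_add_distrib, Finset.sum_comm] at hsum
  simp only [sum_ringForm_perm, ← Finset.sum_filter, Finset.sum_const, Finset.card_univ,
    nsmul_eq_mul] at hsum
  nlinarith [mul_le_mul_of_nonneg_left hcorner (Nat.cast_nonneg (α := ℤ) (Fintype.card ι))]

end Averaging

/-! ### From finite certificates to limits -/

section Limit

variable {n d s : ℕ}

theorem statisticsDensity_le {b : ℝ} (hd : d ≤ n)
    (h : ∀ S : Finset (Fin n → Bool), (#{q : Placement d n | numPoints (coloring S q) = s} : ℝ) ≤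
      b * Fintype.card (Placement d n)) : statisticsDensity d s n ≤ b := by
  obtain ⟨S, -, hS⟩ := Finset.exists_mem_eq_sup Finset.univ Finset.univ_nonempty
    fun S : Finset (Fin n → Bool) => subcubeCount S d s
  rw [statisticsDensity, statisticsFunction, hS, subcubeCount_div S s hd]
  exact (div_le_iff₀ (by exact_mod_cast Placement.card_pos hd)).2 (h S)

theorem le_statisticsDensity {b : ℝ} (hd : d ≤ n) (S : Finset (Fin n → Bool))
    (h : b * Fintype.card (Placement d n) ≤ #{q : Placement d n | numPoints (coloring S q) = s}) :
    b ≤ statisticsDensity d s n := by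
  have hcard : (0 : ℝ) < Fintype.card (Placement d n) := by exact_mod_cast Placement.card_pos hd
  refine ((le_div_iff₀ hcard).2 h).trans ?_
  rw [← subcubeCount_div S s hd, statisticsDensity, statisticsFunction]
  gcongr
  exact Finset.le_sup (f := fun S => subcubeCount S d s) (Finset.mem_univ S)

theorem isStatisticsConstant_of_le_add_div {b K : ℝ} {k : ℕ}
    (lower : ∀ n ≥ d, b ≤ statisticsDensity d s n)
    (upper : ∀ n ≥ d, statisticsDensity d s n ≤ b + K / (n - k : ℕ)) :
    IsStatisticsConstant d s b := by
  have hlim : Filter.Tendsto (fun n : ℕ => b + K / (n - k : ℕ)) Filter.atTop (nhds b) := by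
    simpa using (((tendsto_const_div_atTop_nhds_zero_nat K).comp
      (Filter.tendsto_sub_atTop_nat k)).const_add b)
  refine tendsto_of_tendsto_of_tendsto_of_le_of_le' tendsto_const_nhds hlim ?_ ?_
  · filter_upwards [Filter.eventually_ge_atTop d] with n hn using lower n hn
  · filter_upwards [Filter.eventually_ge_atTop d] with n hn using upper n hn

theorem isStatisticsConstant_of_certificate {m s : ℕ} {ι : Type*} [Fintype ι]
    {t : Coloring m → Matrix (Coloring m) (Coloring m) ℤ} (ht : ∀ σ, (t σ).PosSemidef)
    (π : ι → Equiv.Perm (Fin (m + 2))) {A B : ℤ} (hA : 0 < A)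
    (hcert : ∀ c : Coloring (m + 2), (if numPoints c = s then A else 0) +
      ∑ i, ringForm t (fun u => c (u ∘ π i)) ≤ B)
    {r : ℝ} (hr : r = B / A) (lower : ∀ n ≥ m + 2, r ≤ statisticsDensity (m + 2) s n) :
    IsStatisticsConstant (m + 2) s r := by
  subst hr
  obtain ⟨K, hK⟩ := Finite.exists_le fun p : Coloring m × Coloring m => t p.1 p.2 p.2
  refine isStatisticsConstant_of_le_add_div (K := 4 * Fintype.card ι * K / A) (k := m + 1) lower
    fun n hn => statisticsDensity_le hn fun S => ?_
  have hA' : (0 : ℝ) < A := by exact_mod_cast hA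
  have hn' : ((n - (m + 1) : ℕ) : ℝ) ≠ 0 := by
    rw [Nat.cast_ne_zero]
    omega
  have h : (A * #{q : Placement (m + 2) n | numPoints (coloring S q) = s} : ℝ) ≤
      B * Fintype.card (Placement (m + 2) n) +
        4 * Fintype.card ι * K * Fintype.card (Placement (m + 1) n) := by
    exact_mod_cast mul_card_numPoints_le t S ht (fun σ F => hK (σ, F)) π hcert
  refine le_of_mul_le_mul_left (h.trans_eq ?_) hA'
  rw [Placement.card_succ]
  push_cast
  field_simp

end Limit

/-! ### Lower bounds from linear codes -/

section Code

variable {n d : ℕ} {V : Type*} [AddCommGroup V]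

/-- The syndrome of the binary word `x` for the parity check vectors `a t`. -/
def syndrome (a : Fin n → V) (x : Fin n → Bool) : V := ∑ t, if x t then a t else 0

theorem syndrome_bot (a : Fin n → V) : syndrome a ⊥ = 0 := by simp [syndrome]

variable [Module (ZMod 2) V]

theorem syndrome_flipAt (a : Fin n → V) (x : Fin n → Bool) (t : Fin n) :
    syndrome a (flipAt x t) = syndrome a x + a t := by
  have hrest : ∀ r ∈ ({t}ᶜ : Finset (Fin n)),
      (if flipAt x t r then a r else 0) = if x r then a r else 0 := fun r hr => by
    rw [flipAt_apply_of_ne x (by simpa using hr)]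
  simp only [syndrome, Fintype.sum_eq_add_sum_compl t, Finset.sum_congr rfl hrest,
    flipAt_apply_self]
  cases x t
  · simp [add_comm]
  · simp [add_right_comm _ _ (a t), ZModModule.add_self]

theorem syndrome_vertex (a : Fin n → V) (q : Placement d n) (u : Fin d → Bool) :
    syndrome a (q.vertex u) = syndrome a q.1 + syndrome (a ∘ q.2) u := by
  induction u using flipAt_induction with
  | bot => rw [Placement.vertex_bot, syndrome_bot, add_zero]
  | flip u i ih =>
    rw [Placement.vertex_flipAt, syndrome_flipAt, syndrome_flipAt, ih, add_assoc, Function.comp]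

theorem syndrome_surjective {b : Fin d → V} (hb : Submodule.span (ZMod 2) (Set.range b) = ⊤) :
    Function.Surjective (syndrome b) := by
  intro v
  have hv : v ∈ Submodule.span (ZMod 2) (Set.range b) := hb ▸ Submodule.mem_top
  obtain ⟨c, rfl⟩ := (Submodule.mem_span_range_iff_exists_fun _).1 hv
  refine ⟨fun i => decide (c i = 1), Finset.sum_congr rfl fun i _ => ?_⟩
  rcases (by decide : ∀ z : ZMod 2, z = 0 ∨ z = 1) (c i) with h | h <;> simp [h]

variable [Fintype V]

section DecidableEq

variable [DecidableEq V]

/-- The binary linear code with parity check vectors `a t`. -/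
def codeOf (a : Fin n → V) : Finset (Fin n → Bool) := {x | syndrome a x = 0}

theorem card_syndrome_eq_mul_card {b : Fin d → V} (hb : Function.Surjective (syndrome b)) (w : V) :
    #{u | syndrome b u = w} * Fintype.card V = 2 ^ d := by
  have hle : ∀ v v' : V, #{u | syndrome b u = v} ≤ #{u | syndrome b u = v'} := fun v v' => by
    obtain ⟨z, hz⟩ := hb (v' - v)
    let q : Placement d d := (z, Function.Embedding.refl _)
    refine Finset.card_le_card_of_injOn q.vertex (fun u hu => ?_) q.vertex_injective.injOn
    have hu' : syndrome b u = v := by simpa using hu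
    have hq : syndrome b (q.vertex u) = syndrome b z + syndrome b u := syndrome_vertex b q u
    simpa [hz, hu'] using hq
  calc #{u | syndrome b u = w} * Fintype.card V
      = ∑ v : V, #{u | syndrome b u = v} := by
        rw [Finset.sum_congr rfl fun v _ => (hle v w).antisymm (hle w v), Finset.sum_const,
          smul_eq_mul, mul_comm, Finset.card_univ]
    _ = 2 ^ d := by
        rw [← Finset.card_eq_sum_card_fiberwise fun _ _ => Finset.mem_coe.2 (Finset.mem_univ _)]
        simp

theorem numPoints_coloring_codeOf_mul_card {a : Fin n → V} {q : Placement d n}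
    (h : Function.Surjective (syndrome (a ∘ q.2))) :
    numPoints (coloring (codeOf a) q) * Fintype.card V = 2 ^ d := by
  rw [← card_syndrome_eq_mul_card h (-syndrome a q.1), numPoints, Finset.card_filter]
  congr 1
  refine Finset.sum_congr rfl fun u _ => ?_
  simp only [coloring, codeOf, Finset.mem_filter, Finset.mem_univ, true_and, syndrome_vertex,
    add_comm (syndrome a q.1), eq_neg_iff_add_eq_zero]
  split_ifs with hu <;> simp [hu]

end DecidableEq

theorem card_filter_comp_mul {α β κ : Type*} [Fintype α] [Fintype β] [Fintype κ] [DecidableEq α]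
    [DecidableEq β] (e : α ↪ β) (P : (α → κ) → Prop) [DecidablePred P] :
    #{a : β → κ | P (a ∘ e)} * Fintype.card κ ^ Fintype.card α =
      #{b | P b} * Fintype.card κ ^ Fintype.card β := by
  let exchange : (β → κ) × (α → κ) → (β → κ) × (α → κ) :=
    fun p => (Function.extend e p.2 p.1, p.1 ∘ e)
  have hinv : Function.Involutive exchange := by
    rintro ⟨a, b⟩
    refine Prod.ext (funext fun t => ?_) (funext fun i => ?_)
    · by_cases ht : ∃ i, e i = t
      · obtain ⟨i, rfl⟩ := ht
        exact e.injective.extend_apply _ _ i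
      · exact (Function.extend_apply' _ _ _ ht).trans (Function.extend_apply' _ _ _ ht)
    · exact e.injective.extend_apply _ _ i
  have hcard : #(({a : β → κ | P (a ∘ e)} : Finset _) ×ˢ (Finset.univ : Finset (α → κ))) =
      #((Finset.univ : Finset (β → κ)) ×ˢ ({b | P b} : Finset _)) :=
    Finset.card_equiv hinv.toPerm fun p => by simp [exchange]
  simpa [Finset.card_product, mul_comm] using hcard

theorem exists_card_mul_card_le {κ : Type*} [Fintype κ] [Nonempty κ] (P : (Fin d → κ) → Prop)
    [DecidablePred P] :
    ∃ a : Fin n → κ, #{b | P b} * Fintype.card (Placement d n) ≤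
      #{q : Placement d n | P (a ∘ q.2)} * Fintype.card κ ^ d := by
  suffices h : ∑ _a : Fin n → κ, #{b | P b} * Fintype.card (Placement d n) =
      ∑ a : Fin n → κ, #{q : Placement d n | P (a ∘ q.2)} * Fintype.card κ ^ d by
    obtain ⟨a, -, ha⟩ := Finset.exists_le_of_sum_le Finset.univ_nonempty h.le
    exact ⟨a, ha⟩
  calc ∑ _a : Fin n → κ, #{b | P b} * Fintype.card (Placement d n)
      = ∑ _q : Placement d n, #{b | P b} * Fintype.card κ ^ n := by
        simp only [Finset.sum_const, Finset.card_univ, Fintype.card_fun, Fintype.card_fin,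
          smul_eq_mul]
        ring
    _ = ∑ q : Placement d n, #{a : Fin n → κ | P (a ∘ q.2)} * Fintype.card κ ^ d := by
        refine Finset.sum_congr rfl fun q _ => ?_
        simpa using (card_filter_comp_mul q.2 P).symm
    _ = ∑ a : Fin n → κ, #{q : Placement d n | P (a ∘ q.2)} * Fintype.card κ ^ d := by
        simp only [← Finset.sum_mul, Finset.card_filter]
        rw [Finset.sum_comm]

theorem card_spanning_div_le_statisticsDensity {κ : Type*} [Fintype κ] [Nonempty κ] {s : ℕ}
    (v : κ → V) {P : (Fin d → κ) → Prop} [DecidablePred P]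
    (hP : ∀ b, P b → Submodule.span (ZMod 2) (Set.range (v ∘ b)) = ⊤)
    (hs : s * Fintype.card V = 2 ^ d) (hd : d ≤ n) :
    (#{b | P b} / Fintype.card κ ^ d : ℝ) ≤ statisticsDensity d s n := by
  classical
  obtain ⟨a, ha⟩ := exists_card_mul_card_le (n := n) P
  refine le_statisticsDensity hd (codeOf (v ∘ a)) ?_
  have hle : #{q : Placement d n | P (a ∘ q.2)} ≤
      #{q : Placement d n | numPoints (coloring (codeOf (v ∘ a)) q) = s} := by
    refine Finset.card_le_card (Finset.monotone_filter_right _ fun q _ hq => ?_)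
    have hpoints := numPoints_coloring_codeOf_mul_card (a := v ∘ a) (syndrome_surjective (hP _ hq))
    exact Nat.eq_of_mul_eq_mul_right Fintype.card_pos (hpoints.trans hs.symm)
  rw [div_mul_eq_mul_div, div_le_iff₀ (by positivity)]
  exact_mod_cast ha.trans (Nat.mul_le_mul_right _ hle)

end Code

section Spanning

variable {d k : ℕ}

theorem span_eq_top_of_forall_exists_dotProduct_ne_zero {K : Type*} [Field K] {ι : Type*}
    {b : ι → Fin k → K} (h : ∀ w ≠ 0, ∃ i, w ⬝ᵥ b i ≠ 0) :
    Submodule.span K (Set.range b) = ⊤ := by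
  by_contra hne
  obtain ⟨f, hf, hle⟩ := Submodule.exists_le_ker_of_lt_top _ (lt_top_iff_ne_top.2 hne)
  obtain ⟨w, rfl⟩ := (dotProductEquiv K (Fin k)).surjective f
  obtain ⟨i, hi⟩ := h w (by simpa using hf)
  exact hi (hle (Submodule.subset_span (Set.mem_range_self i)))

/-- The number of words `b : Fin d → κ` such that each element of `T` is related to some `b i`,
in a form that is fast to evaluate. -/
def numHitting {α κ : Type*} [DecidableEq α] [Fintype κ] (r : α → κ → Prop) [DecidableRel r] :
    ℕ → Finset α → ℕ
  | 0, T => if T = ∅ then 1 else 0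
  | d + 1, T => ∑ v, numHitting r d {w ∈ T | ¬ r w v}

theorem card_forall_mem_exists_eq_numHitting {α κ : Type*} [DecidableEq α] [Fintype κ]
    (r : α → κ → Prop) [DecidableRel r] (d : ℕ) (T : Finset α) :
    #{b : Fin d → κ | ∀ w ∈ T, ∃ i, r w (b i)} = numHitting r d T := by
  induction d generalizing T with
  | zero =>
    simp only [numHitting, Finset.eq_empty_iff_forall_notMem, IsEmpty.exists_iff, imp_false,
      Finset.card_filter, Finset.univ_unique, Finset.sum_singleton]
  | succ d ih =>
    simp only [numHitting, ← ih, Finset.card_filter]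
    rw [← (Fin.consEquiv fun _ => κ).sum_comp, Fintype.sum_prod_type]
    refine Finset.sum_congr rfl fun v _ => Finset.sum_congr rfl fun b _ => if_congr ?_ rfl rfl
    simp only [Fin.exists_fin_succ, Fin.consEquiv_apply, Fin.cons_zero, Fin.cons_succ,
      Finset.mem_filter, and_imp, or_iff_not_imp_left]

/-- The nonzero vectors of the `k`-dimensional space over the field with two elements. -/
abbrev NonzeroVector (k : ℕ) : Type := {v : Fin k → ZMod 2 // v ≠ 0}

theorem card_nonzeroVector (k : ℕ) : (Fintype.card (NonzeroVector k) : ℝ) = 2 ^ k - 1 := by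
  simp [Fintype.card_subtype_compl, Nat.cast_sub Nat.one_le_two_pow]

theorem numHitting_div_le_statisticsDensity {n s g : ℕ} [NeZero k]
    (hg : numHitting (fun w v : NonzeroVector k => w.1 ⬝ᵥ v.1 ≠ 0) d Finset.univ = g)
    (hs : s * 2 ^ k = 2 ^ d) (hd : d ≤ n) :
    (g / (2 ^ k - 1) ^ d : ℝ) ≤ statisticsDensity d s n := by
  have : Nonempty (NonzeroVector k) := ⟨1, one_ne_zero⟩
  rw [← hg, ← card_forall_mem_exists_eq_numHitting, ← card_nonzeroVector]
  convert card_spanning_div_le_statisticsDensity (κ := NonzeroVector k) Subtype.val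
    (P := fun b => ∀ w ∈ (Finset.univ : Finset (NonzeroVector k)), ∃ i, w.1 ⬝ᵥ (b i).1 ≠ 0)
    (fun b hb => span_eq_top_of_forall_exists_dotProduct_ne_zero fun w hw =>
      hb ⟨w, hw⟩ (Finset.mem_univ _)) (by simpa using hs) hd

theorem le_statisticsDensity_three_two {n : ℕ} (hn : 3 ≤ n) :
    (8 / 9 : ℝ) ≤ statisticsDensity 3 2 n := by
  refine le_of_eq_of_le ?_ (numHitting_div_le_statisticsDensity (k := 2) (g := 24)
    (by decide +kernel) (by norm_num) hn)
  norm_num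

theorem le_statisticsDensity_four_two {n : ℕ} (hn : 4 ≤ n) :
    (264 / 343 : ℝ) ≤ statisticsDensity 4 2 n := by
  refine le_of_eq_of_le ?_ (numHitting_div_le_statisticsDensity (k := 3) (g := 1848)
    (by decide +kernel) (by norm_num) hn)
  norm_num

theorem le_statisticsDensity_four_four {n : ℕ} (hn : 4 ≤ n) :
    (26 / 27 : ℝ) ≤ statisticsDensity 4 4 n := by
  refine le_of_eq_of_le ?_ (numHitting_div_le_statisticsDensity (k := 2) (g := 78)
    (by decide +kernel) (by norm_num) hn)
  norm_num

end Spanning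

/-! ### Certificates -/

section Gram

/-- The matrix of the quadratic form `∑ w * (∑ a, v a * x a) ^ 2` over the pairs `(w, v)` in `L`,
where the list `v` is continued by zeros. -/
def gram (L : List (ℕ × List ℤ)) : Matrix ℕ ℕ ℤ :=
  fun a b => (L.map fun p => (p.1 : ℤ) * (p.2.getD a 0 * p.2.getD b 0)).sum

theorem posSemidef_mul_mul {α : Type*} (w : ℕ) (v : α → ℤ) :
    Matrix.PosSemidef (fun a b => w * (v a * v b) : Matrix α α ℤ) := by
  refine ⟨Matrix.IsHermitian.ext fun a b => ?_, fun x => ?_⟩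
  · rw [star_trivial, mul_comm (v b)]
  have hsq : (x.sum fun a xa => x.sum fun b xb => star xa * (w * (v a * v b)) * xb) =
      w * (x.sum fun a xa => v a * xa) ^ 2 := by
    simp only [Finsupp.sum]
    rw [sq, Finset.sum_mul_sum, Finset.mul_sum]
    refine Finset.sum_congr rfl fun a _ => ?_
    rw [Finset.mul_sum]
    refine Finset.sum_congr rfl fun b _ => ?_
    rw [star_trivial]
    ring
  rw [hsq]
  positivity

theorem posSemidef_gram (L : List (ℕ × List ℤ)) : (gram L).PosSemidef := by
  induction L with
  | nil => exact Matrix.PosSemidef.zero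
  | cons p L ih => exact (posSemidef_mul_mul p.1 fun a => p.2.getD a 0).add ih

end Gram

section Ring

variable {m : ℕ}

/-- An upper bound for `ringForm`, shifted by `4 * K`, in terms of the numbers `w`, `x`, `y`, `z` of
the four faces on which the first two coordinates are `00`, `10`, `01`, `11`. Natural numbers are
cheap to evaluate, and truncation at `0` can only increase a term. -/
def shiftedRing (t : ℕ → Matrix ℕ ℕ ℤ) (K w x y z : ℕ) : ℕ :=
  (t z y x + K).toNat + (t x w z + K).toNat + ((t y z w + K).toNat + (t w x y + K).toNat)

variable (t : ℕ → Matrix ℕ ℕ ℤ) (K : ℕ) (code : Coloring m → ℕ)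

theorem ringForm_submatrix_add_le (c : Coloring (m + 2)) :
    ringForm (fun σ => (t (code σ)).submatrix code code) c + 4 * K ≤
      shiftedRing t K (code (face c false false)) (code (face c true false))
        (code (face c false true)) (code (face c true true)) := by
  simp only [ringForm, shiftedRing, Fintype.sum_bool, Matrix.submatrix_apply, Bool.not_true,
    Bool.not_false]
  omega

theorem certificate_of_shiftedRing {ι : Type*} [Fintype ι] (π : ι → Equiv.Perm (Fin (m + 2)))
    {s A B : ℕ} {c : Coloring (m + 2)} (h : (if numPoints c = s then A else 0) +
      ∑ i, shiftedRing t K (code (face (fun u => c (u ∘ π i)) false false))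
        (code (face (fun u => c (u ∘ π i)) true false))
        (code (face (fun u => c (u ∘ π i)) false true))
        (code (face (fun u => c (u ∘ π i)) true true)) ≤ B + Fintype.card ι * (4 * K)) :
    (if numPoints c = s then (A : ℤ) else 0) +
      ∑ i, ringForm (fun σ => (t (code σ)).submatrix code code) (fun u => c (u ∘ π i)) ≤ B := by
  have hsum := Finset.sum_le_sum fun (i : ι) (_ : i ∈ Finset.univ) =>
    ringForm_submatrix_add_le t K code fun u => c (u ∘ π i)
  rw [Finset.sum_add_distrib, Finset.sum_const, Finset.card_univ, nsmul_eq_mul] at hsum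
  rw [← Nat.cast_le (α := ℤ)] at h
  push_cast at h
  linarith

theorem face_apply (c : Coloring (m + 2)) (a b : Bool) (w : Fin m → Bool) :
    face c a b w = c (Matrix.vecCons a (Matrix.vecCons b w)) := rfl

theorem sum_fin_succ_bool {d : ℕ} {β : Type*} [AddCommMonoid β] (f : (Fin (d + 1) → Bool) → β) :
    ∑ u, f u = ∑ w, f (Matrix.vecCons true w) + ∑ w, f (Matrix.vecCons false w) := by
  rw [← (Fin.consEquiv fun _ => Bool).sum_comp, Fintype.sum_prod_type, Fintype.sum_bool]
  rfl

end Ring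

section Edge

/-- The number of an edge with colours `a` and `b` at its ends. -/
def edgeNumber (a b : Bool) : ℕ := a.toNat + 2 * b.toNat

/-- Numbers the colourings of an edge. -/
def edgeCode (c : Coloring 1) : ℕ := edgeNumber (c ![false]) (c ![true])

/-- The certificate for exactly two points in a `3`-cube: a form for each coloured edge. -/
def edgeForm : ℕ → Matrix ℕ ℕ ℤ
  | 0 => gram [(1, [2, -1, -1, -1]), (3, [0, 1, -1])]
  | 1 => gram [(1, [1, 0, -2])]
  | 2 => gram [(1, [1, -2])]
  | _ => 0

theorem posSemidef_edgeForm (i : ℕ) : (edgeForm i).PosSemidef := by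
  unfold edgeForm
  split
  all_goals first | exact posSemidef_gram _ | exact Matrix.PosSemidef.zero

theorem edgeForm_inequality : ∀ b₀ b₁ b₂ b₃ b₄ b₅ b₆ b₇ : Bool,
    (if b₀.toNat + b₁.toNat + b₂.toNat + b₃.toNat + b₄.toNat + b₅.toNat + b₆.toNat + b₇.toNat = 2
      then 54 else 0) +
    (shiftedRing edgeForm 2 (edgeNumber b₀ b₄) (edgeNumber b₁ b₅) (edgeNumber b₂ b₆)
      (edgeNumber b₃ b₇) +
    shiftedRing edgeForm 2 (edgeNumber b₀ b₁) (edgeNumber b₄ b₅) (edgeNumber b₂ b₃)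
      (edgeNumber b₆ b₇) +
    shiftedRing edgeForm 2 (edgeNumber b₀ b₂) (edgeNumber b₁ b₃) (edgeNumber b₄ b₆)
      (edgeNumber b₅ b₇)) ≤ 48 + 3 * (4 * 2) := by
  decide +kernel

theorem numPoints_three (c : Coloring 3) : numPoints c =
    (c ![false, false, false]).toNat + (c ![true, false, false]).toNat +
    (c ![false, true, false]).toNat + (c ![true, true, false]).toNat +
    (c ![false, false, true]).toNat + (c ![true, false, true]).toNat +
    (c ![false, true, true]).toNat + (c ![true, true, true]).toNat := by
  simp only [numPoints, sum_fin_succ_bool, Fintype.sum_subsingleton _ ![]]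
  omega

/-- Permutations of the coordinates of the `3`-cube that move each of the three pairs of coordinates
to the front. -/
def edgePerm : Fin 3 → Equiv.Perm (Fin 3) := ![1, Equiv.swap 0 2, Equiv.swap 1 2]

theorem edgeForm_certificate (c : Coloring 3) : (if numPoints c = 2 then ((54 : ℕ) : ℤ) else 0) +
    ∑ i, ringForm (fun σ => (edgeForm (edgeCode σ)).submatrix edgeCode edgeCode)
      (fun u => c (u ∘ edgePerm i)) ≤ (48 : ℕ) := by
  have h := edgeForm_inequality (c ![false, false, false]) (c ![true, false, false])
    (c ![false, true, false]) (c ![true, true, false]) (c ![false, false, true])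
    (c ![true, false, true]) (c ![false, true, true]) (c ![true, true, true])
  have h02 (x y z : Bool) : ![x, y, z] ∘ Equiv.swap (0 : Fin 3) 2 = ![z, y, x] := by
    ext i; fin_cases i <;> rfl
  have h12 (x y z : Bool) : ![x, y, z] ∘ Equiv.swap (1 : Fin 3) 2 = ![x, z, y] := by
    ext i; fin_cases i <;> rfl
  apply certificate_of_shiftedRing edgeForm 2 edgeCode edgePerm
  simp only [Fin.sum_univ_three, numPoints_three, Fintype.card_fin]
  simpa [edgePerm, edgeCode, face_apply, h02, h12] using h

end Edge

section Square

/-- The number of a square with colours `a`, `b`, `c`, `d` at its vertices `00`, `10`, `01`,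
`11`. -/
def squareNumber (a b c d : Bool) : ℕ := a.toNat + 2 * b.toNat + 4 * c.toNat + 8 * d.toNat

/-- Numbers the colourings of a square. -/
def squareCode (c : Coloring 2) : ℕ :=
  squareNumber (c ![false, false]) (c ![true, false]) (c ![false, true]) (c ![true, true])

/-- The action on the numbers of coloured squares of flipping the first coordinate. -/
def flipFst (a : ℕ) : ℕ := 2 * (a % 2) + a / 2 % 2 + 8 * (a / 4 % 2) + 4 * (a / 8)

/-- The action on the numbers of coloured squares of flipping the second coordinate. -/
def flipSnd (a : ℕ) : ℕ := a / 4 + 4 * (a % 4)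

/-- Transports forms `M₀`, `M₁`, `M₂` for the squares with no marked vertex, with the vertex `00`
marked and with `00`, `11` marked to the other squares with at most one marked vertex or with two
opposite ones. The remaining squares carry the form `0`. -/
def squareForm (M₀ M₁ M₂ : Matrix ℕ ℕ ℤ) : ℕ → Matrix ℕ ℕ ℤ
  | 0 => M₀
  | 1 => M₁
  | 2 => M₁.submatrix flipFst flipFst
  | 4 => M₁.submatrix flipSnd flipSnd
  | 6 => M₂.submatrix flipFst flipFst
  | 8 => M₁.submatrix (flipFst ∘ flipSnd) (flipFst ∘ flipSnd)
  | 9 => M₂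
  | _ => 0

theorem posSemidef_squareForm {M₀ M₁ M₂ : Matrix ℕ ℕ ℤ} (h₀ : M₀.PosSemidef) (h₁ : M₁.PosSemidef)
    (h₂ : M₂.PosSemidef) (i : ℕ) : (squareForm M₀ M₁ M₂ i).PosSemidef := by
  unfold squareForm
  split
  all_goals first | assumption | exact h₁.submatrix _ | exact h₂.submatrix _ | exact .zero

/-- The finite check on a colouring of the `4`-cube, given by its values at the vertices in
binary order with the first coordinate as the lowest digit. -/
def SquareInequality (t : ℕ → Matrix ℕ ℕ ℤ) (K s A B : ℕ)
    (b₀ b₁ b₂ b₃ b₄ b₅ b₆ b₇ b₈ b₉ b₁₀ b₁₁ b₁₂ b₁₃ b₁₄ b₁₅ : Bool) : Prop :=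
  (if b₀.toNat + b₁.toNat + b₂.toNat + b₃.toNat + b₄.toNat + b₅.toNat + b₆.toNat + b₇.toNat +
      b₈.toNat + b₉.toNat + b₁₀.toNat + b₁₁.toNat + b₁₂.toNat + b₁₃.toNat + b₁₄.toNat +
      b₁₅.toNat = s then A else 0) +
    (shiftedRing t K (squareNumber b₀ b₄ b₈ b₁₂) (squareNumber b₁ b₅ b₉ b₁₃)
      (squareNumber b₂ b₆ b₁₀ b₁₄) (squareNumber b₃ b₇ b₁₁ b₁₅) +
    shiftedRing t K (squareNumber b₀ b₁ b₈ b₉) (squareNumber b₄ b₅ b₁₂ b₁₃)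
      (squareNumber b₂ b₃ b₁₀ b₁₁) (squareNumber b₆ b₇ b₁₄ b₁₅) +
    shiftedRing t K (squareNumber b₀ b₄ b₁ b₅) (squareNumber b₈ b₁₂ b₉ b₁₃)
      (squareNumber b₂ b₆ b₃ b₇) (squareNumber b₁₀ b₁₄ b₁₁ b₁₅) +
    shiftedRing t K (squareNumber b₀ b₂ b₈ b₁₀) (squareNumber b₁ b₃ b₉ b₁₁)
      (squareNumber b₄ b₆ b₁₂ b₁₄) (squareNumber b₅ b₇ b₁₃ b₁₅) +
    shiftedRing t K (squareNumber b₀ b₄ b₂ b₆) (squareNumber b₁ b₅ b₃ b₇)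
      (squareNumber b₈ b₁₂ b₁₀ b₁₄) (squareNumber b₉ b₁₃ b₁₁ b₁₅) +
    shiftedRing t K (squareNumber b₀ b₁ b₂ b₃) (squareNumber b₄ b₅ b₆ b₇)
      (squareNumber b₈ b₉ b₁₀ b₁₁) (squareNumber b₁₂ b₁₃ b₁₄ b₁₅)) ≤ B + 6 * (4 * K)

/-- Permutations of the coordinates of the `4`-cube that move each of the six pairs of coordinates
to the front. -/
def squarePerm : Fin 6 → Equiv.Perm (Fin 4) :=
  ![1, Equiv.swap 0 2, Equiv.swap 0 3, Equiv.swap 1 2, Equiv.swap 1 3,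
    Equiv.swap 0 2 * Equiv.swap 1 3]

theorem numPoints_four (c : Coloring 4) : numPoints c =
    (c ![false, false, false, false]).toNat + (c ![true, false, false, false]).toNat +
    (c ![false, true, false, false]).toNat + (c ![true, true, false, false]).toNat +
    (c ![false, false, true, false]).toNat + (c ![true, false, true, false]).toNat +
    (c ![false, true, true, false]).toNat + (c ![true, true, true, false]).toNat +
    (c ![false, false, false, true]).toNat + (c ![true, false, false, true]).toNat +
    (c ![false, true, false, true]).toNat + (c ![true, true, false, true]).toNat +
    (c ![false, false, true, true]).toNat + (c ![true, false, true, true]).toNat +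
    (c ![false, true, true, true]).toNat + (c ![true, true, true, true]).toNat := by
  simp only [numPoints, sum_fin_succ_bool, Fintype.sum_subsingleton _ ![]]
  omega

theorem certificate_of_squareInequality {t : ℕ → Matrix ℕ ℕ ℤ} {K s A B : ℕ}
    (h : ∀ b₀ b₁ b₂ b₃ b₄ b₅ b₆ b₇ b₈ b₉ b₁₀ b₁₁ b₁₂ b₁₃ b₁₄ b₁₅,
      SquareInequality t K s A B b₀ b₁ b₂ b₃ b₄ b₅ b₆ b₇ b₈ b₉ b₁₀ b₁₁ b₁₂ b₁₃ b₁₄ b₁₅)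
    (c : Coloring 4) : (if numPoints c = s then (A : ℤ) else 0) +
      ∑ i, ringForm (fun σ => (t (squareCode σ)).submatrix squareCode squareCode)
        (fun u => c (u ∘ squarePerm i)) ≤ B := by
  have hc := h (c ![false, false, false, false]) (c ![true, false, false, false])
    (c ![false, true, false, false]) (c ![true, true, false, false])
    (c ![false, false, true, false]) (c ![true, false, true, false])
    (c ![false, true, true, false]) (c ![true, true, true, false])
    (c ![false, false, false, true]) (c ![true, false, false, true])
    (c ![false, true, false, true]) (c ![true, true, false, true])
    (c ![false, false, true, true]) (c ![true, false, true, true])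
    (c ![false, true, true, true]) (c ![true, true, true, true])
  have h02 (x y z w : Bool) : ![x, y, z, w] ∘ Equiv.swap (0 : Fin 4) 2 = ![z, y, x, w] := by
    ext i; fin_cases i <;> rfl
  have h03 (x y z w : Bool) : ![x, y, z, w] ∘ Equiv.swap (0 : Fin 4) 3 = ![w, y, z, x] := by
    ext i; fin_cases i <;> rfl
  have h12 (x y z w : Bool) : ![x, y, z, w] ∘ Equiv.swap (1 : Fin 4) 2 = ![x, z, y, w] := by
    ext i; fin_cases i <;> rfl
  have h13 (x y z w : Bool) : ![x, y, z, w] ∘ Equiv.swap (1 : Fin 4) 3 = ![x, w, z, y] := by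
    ext i; fin_cases i <;> rfl
  apply certificate_of_shiftedRing t K squareCode squarePerm
  simp only [Fin.sum_univ_six, numPoints_four, Fintype.card_fin]
  simpa [SquareInequality, squarePerm, squareCode, face_apply, h02, h03, h12, h13,
    ← Function.comp_assoc] using hc

/-- The certificate for exactly four points in a `4`-cube. -/
def fourPointForm : ℕ → Matrix ℕ ℕ ℤ :=
  squareForm
    (gram [(13, [4, 3, 3, -2, 3, -2, -2, 0, 3, -2, -2, 0, -2]),
      (40, [0, 0, 0, 0, 0, 0, 1, 0, 0, -1])])
    (gram [(20, [0, 2, 1, 2, 1, 2, 2, 0, -2, 0, -3, 0, -3, 0, -2]),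
      (260, [1, 0, 0, -1, 0, -1, -1, 0, 0, 0, -1, 0, -1, 0, -1, 1]),
      (68, [0, 0, 1, 0, -1])])
    (gram [(52, [1, 0, 0, 0, 0, 0, -2])])

/-- The certificate for exactly two points in a `4`-cube. -/
def twoPointForm : ℕ → Matrix ℕ ℕ ℤ :=
  squareForm
    (gram [(1782, [4, -3, -3, 0, -3, 0, -10, 0, -3, -10]),
      (5873, [0, -1, 1, 0, 1, 0, 4, 0, -1, -4]),
      (17332, [0, 1, -1, 0, -1, 0, 0, 0, 1]),
      (73038, [0, 1, 0, 0, 0, 0, 0, 0, -1]),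
      (73038, [0, 0, 1, 0, -1])])
    (gram [(1859, [3, -5, -4, 0, -4, 0, 0, 0, -4]),
      (5040, [0, 0, 1, 0, 1, 0, 0, 0, -2]),
      (60256, [0, 0, 1, 0, -1])])
    (gram [(792, [1, 0, 0, 0, 0, 0, -6])])

theorem posSemidef_fourPointForm (i : ℕ) : (fourPointForm i).PosSemidef :=
  posSemidef_squareForm (posSemidef_gram _) (posSemidef_gram _) (posSemidef_gram _) i

theorem posSemidef_twoPointForm (i : ℕ) : (twoPointForm i).PosSemidef :=
  posSemidef_squareForm (posSemidef_gram _) (posSemidef_gram _) (posSemidef_gram _) i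

theorem squareInequality_fourPointForm : ∀ b₀ b₁ b₂ b₃ b₄ b₅ b₆ b₇ b₈ b₉ b₁₀ b₁₁ b₁₂ b₁₃ b₁₄ b₁₅,
    SquareInequality fourPointForm 260 4 5184 4992
      b₀ b₁ b₂ b₃ b₄ b₅ b₆ b₇ b₈ b₉ b₁₀ b₁₁ b₁₂ b₁₃ b₁₄ b₁₅ := by
  unfold SquareInequality
  decide +kernel

theorem squareInequality_twoPointForm : ∀ b₀ b₁ b₂ b₃ b₄ b₅ b₆ b₇ b₈ b₉ b₁₀ b₁₁ b₁₂ b₁₃ b₁₄ b₁₅,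
    SquareInequality twoPointForm 71280 2 889056 684288
      b₀ b₁ b₂ b₃ b₄ b₅ b₆ b₇ b₈ b₉ b₁₀ b₁₁ b₁₂ b₁₃ b₁₄ b₁₅ := by
  unfold SquareInequality
  decide +kernel

end Square

theorem theorem3 :
    IsStatisticsConstant 3 2 (8 / 9) ∧
    IsStatisticsConstant 4 2 (264 / 343) ∧
    IsStatisticsConstant 4 4 (26 / 27) := by
  refine ⟨?_, ?_, ?_⟩
  · exact isStatisticsConstant_of_certificate (fun σ => (posSemidef_edgeForm _).submatrix edgeCode)
      edgePerm (by norm_num) edgeForm_certificate (by norm_num)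
      fun n hn => le_statisticsDensity_three_two hn
  · exact isStatisticsConstant_of_certificate
      (fun σ => (posSemidef_twoPointForm _).submatrix squareCode) squarePerm (by norm_num)
      (certificate_of_squareInequality squareInequality_twoPointForm) (by norm_num)
      fun n hn => le_statisticsDensity_four_two hn
  · exact isStatisticsConstant_of_certificate
      (fun σ => (posSemidef_fourPointForm _).submatrix squareCode) squarePerm (by norm_num)
      (certificate_of_squareInequality squareInequality_fourPointForm) (by norm_num)
      fun n hn => le_statisticsDensity_four_four hn
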